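/- Let $q\ge 2$ be an integer. A linear lattice Boltzmann scheme is given by discrete velocities $c_1,\dots,c_q\in\mathbb Z$, a moment matrix $M\in GL_q(\mathbb R)$, an equilibrium vector $\epsilon\in\mathbb R^q$ with $\epsilon_1=1$, and relaxation parameters $s_1\in\mathbb R$, $s_2,\dots,s_q\in(0,2]$. Let $\mathsf T$ be the forward shift, $(\mathsf T u)_j=u_{j+1}$, and put $$K:=I+\mathrm{diag}(s_1,\dots,s_q)(\epsilon e_1^{\mathsf T}-I),\qquad E:=M\,\mathrm{diag}(\mathsf T^{-c_1},\dots,\mathsf T^{-c_q})\,M^{-1}K ,$$ a $q\times q$ matrix over the ring of Laurent polynomials $\mathbb R[\mathsf T,\mathsf T^{-1}]$. The scheme on the infinite domain is $\mathbf m^{n+1}_j=E\,\mathbf m^n_j$, $n\in\mathbb N$, $j\in\mathbb Z$, with $\mathbf m^n_j\in\mathbb R^q$. It is called $L^2$ stable if, for every norm $|\cdot|$ on $\mathbb R^q$, there is $C>0$ such that for all $\Delta x>0$, all square-summable initial data $(\mathbf m^0_j)_{j\in\mathbb Z}$ and all $n\in\mathbb N$, $$\sum_{j\in\mathbb Z}\Delta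 x\,|\mathbf m^n_j|^2\le C\sum_{j\in\mathbb Z}\Delta x\,|\mathbf m^0_j|^2 .$$ Let $s$ be the number of indices $\ell\in\{2,\dots,q\}$ with $s_\ell\ne1$, and write $\det(zI-E)=z^q+\sum_{\ell=q-1-s}^{q-1}\gamma_\ell z^\ell$ with $\gamma_\ell\in\mathbb R[\mathsf T,\mathsf T^{-1}]$. The corresponding finite-difference scheme is $$u^{n+1}_j=-\sum_{\ell=0}^{s}\gamma_{q-\ell-1}u^{n-\ell}_j,\qquad n\ge s,\ j\in\mathbb Z ,$$ with initial data $u^0,\dots,u^s$. It is called $L^2$ stable if there is $C>0$ such that for all $\Delta x>0$, all square-summable real initial data $u^0,\dots,u^s$ and all $n\in\mathbb N$, $$\sum_{j\in\mathbb Z}\Delta x\,|u^n_j|^2\le C\sum_{\ell=0}^{s}\sum_{j\in\mathbb Z}\Delta x\,|u^\ell_j|^2 .$$ **Proposition.** If the finite-difference scheme generated by $\det(zI-E)$ is $L^2$ stable, then the lattice Boltzmann scheme is $L^2$ stable. The converse is false: there is a lattice Boltzmann scheme which is $L^2$ stable while its corresponding finite-difference scheme is not; it can be chosen with $\max_i c_i\ge0\ge\min_i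 c_i$ and consistent with a transport equation $\partial_tu+V\partial_xu=0$, $V\neq0$, in the sense that $\lambda\, e_1^{\mathsf T}M\,\mathrm{diag}(c_1,\dots,c_q)M^{-1}\epsilon=V$ for some lattice velocity $\lambda>0$. -/

import Mathlib

open scoped LaurentPolynomial

noncomputable section

/-- A linear multiple-relaxation-times lattice Boltzmann scheme on the one-dimensional lattice `ℤ`
with `q ≥ 2` discrete velocities. Indices run over `Fin q`; the conserved moment, which has
number `1` in the usual one-based numbering, has index `0`. -/
structure LatticeBoltzmannScheme (q : ℕ) where
  two_le : 2 ≤ q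
  /-- the discrete velocities -/
  c : Fin q → ℤ
  /-- the moment matrix -/
  M : Matrix.GeneralLinearGroup (Fin q) ℝ
  /-- the linear equilibria `m ↦ ε m` -/
  ε : Fin q → ℝ
  /-- the relaxation parameters -/
  s : Fin q → ℝ
  ε_first : ε ⟨0, by omega⟩ = 1
  s_mem : ∀ i : Fin q, i ≠ ⟨0, by omega⟩ → s i ∈ Set.Ioc (0 : ℝ) 2

/-- The action on bi-infinite sequences of a Laurent polynomial `P = ∑ₖ Pₖ Tᵏ`, where `T` is the
forward space shift, `(T u)ⱼ = uⱼ₊₁`; that is, `(P u)ⱼ = ∑ₖ Pₖ uⱼ₊ₖ`. -/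
def shiftApply (P : ℝ[T;T⁻¹]) (u : ℤ → ℝ) (j : ℤ) : ℝ :=
  P.coeff.sum fun k a => a * u (j + k)

namespace LatticeBoltzmannScheme

variable {q : ℕ} (L : LatticeBoltzmannScheme q)

/-- The index of the conserved moment. -/
def first : Fin q := ⟨0, by have := L.two_le; omega⟩

/-- The relaxation matrix `K = I + diag(s) (ε e₁ᵀ - I)`. -/
def K : Matrix (Fin q) (Fin q) ℝ :=
  1 + Matrix.diagonal L.s * (Matrix.vecMulVec L.ε (Pi.single L.first 1) - 1)

/-- The scheme matrix `E = M diag(T^{-c₁}, …, T^{-c_q}) M⁻¹ K`, with Laurent polynomial entries. -/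
def E : Matrix (Fin q) (Fin q) ℝ[T;T⁻¹] :=
  L.M.val.map LaurentPolynomial.C
    * Matrix.diagonal (fun i => LaurentPolynomial.T (-(L.c i)))
    * (L.M⁻¹).val.map LaurentPolynomial.C
    * L.K.map LaurentPolynomial.C

/-- `m n j i` is the value of the `i`-th moment at time step `n` and grid point `j`; the sequence
of moments is produced by the scheme on the infinite domain: `mⱼⁿ⁺¹ = E mⱼⁿ` for `j ∈ ℤ`. -/
def IsSolution (m : ℕ → ℤ → Fin q → ℝ) : Prop :=
  ∀ (n : ℕ) (j : ℤ) (i : Fin q),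
    m (n + 1) j i = ∑ k : Fin q, shiftApply (L.E i k) (fun l => m n l k) j

/-- `L²` stability of the lattice Boltzmann scheme on the infinite domain, for every norm `N`
on `ℝ^q`. -/
def L2Stable : Prop :=
  ∀ N : Seminorm ℝ (Fin q → ℝ), (∀ v, N v = 0 → v = 0) →
    ∃ C : ℝ, 0 < C ∧ ∀ Δx : ℝ, 0 < Δx → ∀ m : ℕ → ℤ → Fin q → ℝ, L.IsSolution m →
      (Summable fun j : ℤ => Δx * N (m 0 j) ^ 2) →
      ∀ n : ℕ, (Summable fun j : ℤ => Δx * N (m n j) ^ 2) ∧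
        ∑' j : ℤ, Δx * N (m n j) ^ 2 ≤ C * ∑' j : ℤ, Δx * N (m 0 j) ^ 2

/-- The number `s` of non-conserved moments that do not relax on their equilibrium. -/
def numNonEq : ℕ :=
  (Finset.univ.filter fun i : Fin q => i ≠ L.first ∧ L.s i ≠ 1).card

/-- The coefficient `γ_ℓ` of `z^ℓ` in `det(z I - E)`. -/
def γ (l : ℕ) : ℝ[T;T⁻¹] := L.E.charpoly.coeff l

/-- `u` solves the `(s+1)`-step finite difference scheme generated by `det(z I - E)`:
`uⱼⁿ⁺¹ = - ∑_{ℓ=0}^{s} γ_{q-ℓ-1} uⱼⁿ⁻ˡ` for `n ≥ s` and `j ∈ ℤ`. As `s ≤ q - 1`, the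
subtractions in `ℕ` are genuine. -/
def IsFDSolution (u : ℕ → ℤ → ℝ) : Prop :=
  ∀ n : ℕ, L.numNonEq ≤ n → ∀ j : ℤ,
    u (n + 1) j
      = -∑ l ∈ Finset.range (L.numNonEq + 1), shiftApply (L.γ (q - l - 1)) (u (n - l)) j

/-- `L²` stability of the finite difference scheme generated by `det(z I - E)`. The scheme has
`s + 1` steps, so that its initial data are `u⁰, …, uˢ`. -/
def FDStable : Prop :=
  ∃ C : ℝ, 0 < C ∧ ∀ Δx : ℝ, 0 < Δx → ∀ u : ℕ → ℤ → ℝ, L.IsFDSolution u →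
    (∀ l ∈ Finset.range (L.numNonEq + 1), Summable fun j : ℤ => Δx * |u l j| ^ 2) →
    ∀ n : ℕ, (Summable fun j : ℤ => Δx * |u n j| ^ 2) ∧
      ∑' j : ℤ, Δx * |u n j| ^ 2
        ≤ C * ∑ l ∈ Finset.range (L.numNonEq + 1), ∑' j : ℤ, Δx * |u l j| ^ 2

/-- The consistency condition `lam e₁ᵀ M diag(c) M⁻¹ ε = V` with the transport equation
`∂ₜ u + V ∂ₓ u = 0`, where `lam` is the lattice velocity. -/
def IsConsistent (V lam : ℝ) : Prop :=
  lam * (L.M.val * Matrix.diagonal (fun i => (L.c i : ℝ)) * (L.M⁻¹).val).mulVec L.ε L.first = V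

end LatticeBoltzmannScheme

end

open scoped ENNReal

noncomputable section

/-! Stability of the finite-difference scheme passes to the lattice Boltzmann scheme by
Cayley-Hamilton over the commutative ring of Laurent polynomials: each moment satisfies the
recurrence given by `det(zI - E)` (`IsSolution.sum_charpoly_coeff`). A relaxation parameter equal to
1 kills a column of `E`, so the lowest coefficients vanish (`γ_eq_zero`) and the recurrence has `s +
1` steps. The first few time levels are controlled by boundedness of the powers of `E`, the later
ones by `FDStable`.

The converse fails because a characteristic polynomial does not see diagonalizability. With all
relaxation parameters equal to 2, `K` is an involution, and for three velocities its eigenvalue -1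
is double but semisimple. Collision is then an isometry for a weighted norm on the distribution
functions and transport preserves it, so the scheme is stable (`l2Stable_of_collision_le`). On
sequences constant in space the recurrence has characteristic polynomial `(X - 1)(X + 1)^2`, whose
double root on the unit circle gives the growing solution `(-1)^n n`; truncating it in space
contradicts stability (`not_fdStable_of_unbounded`). -/

/-! ### Laurent polynomials acting on square-summable sequences -/

/-- The action of Laurent polynomials on sequences, as a homomorphism of algebras. -/
def shiftHom : ℝ[T;T⁻¹] →ₐ[ℝ] Module.End ℝ (ℤ → ℝ) :=
  AddMonoidAlgebra.lift ℝ (Module.End ℝ (ℤ → ℝ)) ℤ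
    { toFun := fun k => LinearMap.funLeft ℝ ℝ fun j => j + k.toAdd
      map_one' := by ext u j; simp [LinearMap.funLeft_apply]
      map_mul' := fun a b => by
        ext u j
        simp only [LinearMap.funLeft_apply, Module.End.mul_apply, toAdd_mul]
        congr 1; ring }

lemma shiftApply_eq (P : ℝ[T;T⁻¹]) (u : ℤ → ℝ) : shiftApply P u = shiftHom P u := by
  ext j
  simp [shiftApply, shiftHom, AddMonoidAlgebra.lift_apply, Finsupp.sum, LinearMap.funLeft_apply]

lemma shiftHom_C (a : ℝ) (u : ℤ → ℝ) : shiftHom (LaurentPolynomial.C a) u = a • u := by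
  rw [LaurentPolynomial.C_eq_algebraMap, AlgHom.commutes]; rfl

lemma shiftHom_T (k : ℤ) (u : ℤ → ℝ) (j : ℤ) :
    shiftHom (LaurentPolynomial.T k) u j = u (j + k) := by
  have : shiftHom (LaurentPolynomial.T k) = LinearMap.funLeft ℝ ℝ fun j => j + k := by
    rw [shiftHom, LaurentPolynomial.T, AddMonoidAlgebra.lift_single, one_smul]
    rfl
  rw [this, LinearMap.funLeft_apply]

/-- The sum of the squares of a sequence. -/
def sqSum (u : ℤ → ℝ) : ℝ≥0∞ := ∑' j, ENNReal.ofReal (u j ^ 2)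

lemma sqSum_add_le (u v : ℤ → ℝ) : sqSum (u + v) ≤ 2 * (sqSum u + sqSum v) := by
  unfold sqSum
  rw [← ENNReal.tsum_add, ← ENNReal.tsum_mul_left]
  refine ENNReal.tsum_le_tsum fun j => ?_
  rw [← ENNReal.ofReal_add (sq_nonneg _) (sq_nonneg _), ← ENNReal.ofReal_ofNat,
    ← ENNReal.ofReal_mul (by norm_num)]
  exact ENNReal.ofReal_le_ofReal (by simp only [Pi.add_apply]; nlinarith [sq_nonneg (u j - v j)])

lemma sqSum_smul (a : ℝ) (u : ℤ → ℝ) : sqSum (a • u) = ENNReal.ofReal (a ^ 2) * sqSum u := by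
  unfold sqSum
  rw [← ENNReal.tsum_mul_left]
  refine tsum_congr fun j => ?_
  rw [← ENNReal.ofReal_mul (sq_nonneg _)]
  simp [mul_pow]

lemma sqSum_shift (k : ℤ) (u : ℤ → ℝ) : sqSum (fun j => u (j + k)) = sqSum u :=
  (Equiv.addRight k).tsum_eq fun j => ENNReal.ofReal (u j ^ 2)

lemma exists_sqSum_shiftHom_le (P : ℝ[T;T⁻¹]) :
    ∃ C : ℝ≥0∞, C ≠ ⊤ ∧ ∀ u, sqSum (shiftHom P u) ≤ C * sqSum u := by
  induction P using LaurentPolynomial.induction_on' with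
  | add p q hp hq =>
    obtain ⟨A, hA, hA'⟩ := hp
    obtain ⟨B, hB, hB'⟩ := hq
    refine ⟨2 * (A + B), by finiteness, fun u => ?_⟩
    rw [map_add, LinearMap.add_apply, mul_assoc, add_mul]
    exact (sqSum_add_le _ _).trans (by gcongr <;> simp [hA', hB'])
  | C_mul_T k a =>
    refine ⟨ENNReal.ofReal (a ^ 2), by finiteness, fun u => ?_⟩
    rw [map_mul, Module.End.mul_apply, shiftHom_C, sqSum_smul, funext (shiftHom_T k u),
      sqSum_shift]

lemma sqSum_sum_le {ι : Type*} (s : Finset ι) (u : ι → ℤ → ℝ) :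
    sqSum (∑ i ∈ s, u i) ≤ s.card * ∑ i ∈ s, sqSum (u i) := by
  have h (j : ℤ) : ENNReal.ofReal ((∑ i ∈ s, u i) j ^ 2)
      ≤ s.card * ∑ i ∈ s, ENNReal.ofReal (u i j ^ 2) := by
    rw [← ENNReal.ofReal_sum_of_nonneg fun i _ => sq_nonneg _, ← ENNReal.ofReal_natCast,
      ← ENNReal.ofReal_mul (by positivity), Finset.sum_apply]
    exact ENNReal.ofReal_le_ofReal sq_sum_le_card_mul_sum_sq
  refine (ENNReal.tsum_le_tsum h).trans_eq ?_
  rw [ENNReal.tsum_mul_left, Summable.tsum_finsetSum fun i _ => ENNReal.summable]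
  rfl

lemma summable_and_tsum_le {f g : ℤ → ℝ} (hf : ∀ j, 0 ≤ f j) (hg : ∀ j, 0 ≤ g j)
    (hgs : Summable g) {C : ℝ} (hC : 0 ≤ C)
    (h : ∑' j, ENNReal.ofReal (f j) ≤ ENNReal.ofReal C * ∑' j, ENNReal.ofReal (g j)) :
    Summable f ∧ ∑' j, f j ≤ C * ∑' j, g j := by
  rw [← ENNReal.ofReal_tsum_of_nonneg hg hgs, ← ENNReal.ofReal_mul hC] at h
  have hfs : Summable f := by
    have := ENNReal.summable_toReal (ne_top_of_le_ne_top ENNReal.ofReal_ne_top h)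
    simpa [ENNReal.toReal_ofReal, hf] using this
  refine ⟨hfs, ?_⟩
  rw [← ENNReal.ofReal_tsum_of_nonneg hf hfs] at h
  exact (ENNReal.ofReal_le_ofReal_iff (mul_nonneg hC (tsum_nonneg hg))).1 h

lemma summable_of_sqSum_ne_top {u : ℤ → ℝ} (h : sqSum u ≠ ⊤) : Summable fun j => u j ^ 2 := by
  have := ENNReal.summable_toReal h
  simpa [ENNReal.toReal_ofReal, sq_nonneg] using this

lemma ofReal_tsum_sq {u : ℤ → ℝ} (h : Summable fun j => u j ^ 2) :
    ENNReal.ofReal (∑' j, u j ^ 2) = sqSum u :=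
  ENNReal.ofReal_tsum_of_nonneg (fun _ => sq_nonneg _) h

/-! ### Equivalence of norms and reduction to sums of squares -/

lemma Seminorm.exists_le_mul_norm {q : ℕ} (N : Seminorm ℝ (Fin q → ℝ)) :
    ∃ b : ℝ, 0 < b ∧ ∀ v, N v ≤ b * ‖v‖ := by
  refine ⟨1 + ∑ i, N (Pi.single i 1), by positivity, fun v => ?_⟩
  calc N v = N (∑ i, v i • Pi.single i (1 : ℝ)) := by rw [← pi_eq_sum_univ']
    _ ≤ ∑ i, N (v i • Pi.single i (1 : ℝ)) := Finset.le_sum_of_subadditive N (map_zero N).le (map_add_le_add N) _ _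
    _ ≤ ∑ i, ‖v‖ * N (Pi.single i (1 : ℝ)) := by
      gcongr with i
      rw [map_smul_eq_mul]
      gcongr
      exact norm_le_pi_norm v i
    _ ≤ (1 + ∑ i, N (Pi.single i 1)) * ‖v‖ := by
      rw [← Finset.mul_sum]; nlinarith [norm_nonneg v]

lemma Seminorm.exists_mul_norm_le {q : ℕ} (N : Seminorm ℝ (Fin q → ℝ))
    (hN : ∀ v, N v = 0 → v = 0) : ∃ a : ℝ, 0 < a ∧ ∀ v, a * ‖v‖ ≤ N v := by
  obtain ⟨b, hb, hbN⟩ := N.exists_le_mul_norm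
  have hcont : Continuous N := by
    refine (LipschitzWith.of_le_add_mul ⟨b, hb.le⟩ fun v w => ?_).continuous
    have := map_add_le_add N w (v - w)
    rw [add_sub_cancel] at this
    rw [dist_eq_norm]
    exact this.trans (by gcongr; exact hbN _)
  -- The sphere is empty only for `q = 0`; otherwise `N` attains a positive minimum on it by
  -- compactness.
  rcases (Metric.sphere (0 : Fin q → ℝ) 1).eq_empty_or_nonempty with h | h
  · refine ⟨1, one_pos, fun v => ?_⟩
    by_cases hv : v = 0
    · simp [hv]
    · have : ‖v‖⁻¹ • v ∈ Metric.sphere (0 : Fin q → ℝ) 1 := by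
        simp [norm_smul, hv]
      simp [h] at this
  · obtain ⟨x, hx, hmin⟩ := (isCompact_sphere _ _).exists_isMinOn h hcont.continuousOn
    have hx0 : x ≠ 0 := by rintro rfl; simp at hx
    refine ⟨N x, (apply_nonneg N x).lt_of_ne fun h0 => hx0 (hN x h0.symm), fun v => ?_⟩
    by_cases hv : v = 0
    · simp [hv]
    · have hv' : 0 < ‖v‖ := norm_pos_iff.2 hv
      have : N x ≤ N (‖v‖⁻¹ • v) := hmin (by simp [norm_smul, hv])
      rw [map_smul_eq_mul, norm_inv, norm_norm, inv_mul_eq_div, le_div_iff₀ hv'] at this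
      exact this

namespace LatticeBoltzmannScheme

variable {q : ℕ} (L : LatticeBoltzmannScheme q)

/-- All norms are equivalent and `Δx` cancels, so one estimate in `ℝ≥0∞`, free of summability
conditions, suffices. -/
lemma L2Stable_of_sqSum_le {C : ℝ≥0∞} (hC : C ≠ ⊤)
    (h : ∀ m, L.IsSolution m → ∀ n,
      ∑ i, sqSum (fun j => m n j i) ≤ C * ∑ i, sqSum (fun j => m 0 j i)) : L.L2Stable := by
  intro N hN
  obtain ⟨b, hb, hbN⟩ := N.exists_le_mul_norm
  obtain ⟨a, ha, haN⟩ := N.exists_mul_norm_le hN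
  have hq : (0 : ℝ) < q := by have := L.two_le; positivity
  have key (v : ℤ → Fin q → ℝ) :
      ∑ i, sqSum (fun j => v j i) = ∑' j, ENNReal.ofReal (∑ i, v j i ^ 2) := by
    unfold sqSum
    rw [← Summable.tsum_finsetSum fun i _ => ENNReal.summable]
    exact tsum_congr fun j => (ENNReal.ofReal_sum_of_nonneg fun i _ => sq_nonneg _).symm
  have hup (v : Fin q → ℝ) : N v ^ 2 ≤ b ^ 2 * ∑ i, v i ^ 2 := by
    have h1 : ‖v‖ ^ 2 ≤ ∑ i, v i ^ 2 := by
      refine (Real.le_sqrt (norm_nonneg _) (by positivity)).1 ?_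
      refine (pi_norm_le_iff_of_nonneg (Real.sqrt_nonneg _)).2 fun i => Real.le_sqrt_of_sq_le ?_
      rw [Real.norm_eq_abs, sq_abs]
      exact Finset.single_le_sum (f := fun i => v i ^ 2) (fun _ _ => sq_nonneg _)
        (Finset.mem_univ i)
    calc N v ^ 2 ≤ (b * ‖v‖) ^ 2 := by gcongr; exact hbN v
      _ ≤ _ := by rw [mul_pow]; gcongr
  have hlow (v : Fin q → ℝ) : ∑ i, v i ^ 2 ≤ q / a ^ 2 * N v ^ 2 := by
    have h1 : ∑ i, v i ^ 2 ≤ q * ‖v‖ ^ 2 := by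
      have : ∑ i : Fin q, v i ^ 2 ≤ ∑ _i : Fin q, ‖v‖ ^ 2 := by
        refine Finset.sum_le_sum fun i _ => ?_
        rw [← sq_abs (v i), ← Real.norm_eq_abs]
        gcongr
        exact norm_le_pi_norm v i
      simpa using this
    rw [div_mul_eq_mul_div, le_div_iff₀ (by positivity)]
    have h2 : (a * ‖v‖) ^ 2 ≤ N v ^ 2 := by gcongr; exact haN v
    nlinarith
  -- The summand 1 only makes the constant positive, as `C` may be zero.
  refine ⟨b ^ 2 * C.toReal * (q / a ^ 2) + 1, by positivity, fun Δx hΔ m hm h0 n => ?_⟩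
  have hpos (k : ℕ) (j : ℤ) : 0 ≤ Δx * N (m k j) ^ 2 := by positivity
  have := summable_and_tsum_le (C := b ^ 2 * C.toReal * (q / a ^ 2)) (hpos n) (hpos 0) h0
    (by positivity) ?_
  · refine ⟨this.1, this.2.trans ?_⟩
    exact mul_le_mul_of_nonneg_right (by linarith) (tsum_nonneg (hpos 0))
  · calc ∑' j, ENNReal.ofReal (Δx * N (m n j) ^ 2)
        ≤ ∑' j, ENNReal.ofReal (Δx * b ^ 2) * ENNReal.ofReal (∑ i, m n j i ^ 2) := by
          refine ENNReal.tsum_le_tsum fun j => ?_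
          rw [← ENNReal.ofReal_mul (by positivity), mul_assoc]
          gcongr
          exact hup _
      _ = ENNReal.ofReal (Δx * b ^ 2) * ∑ i, sqSum (fun j => m n j i) := by
          rw [ENNReal.tsum_mul_left, key]
      _ ≤ ENNReal.ofReal (Δx * b ^ 2) * (ENNReal.ofReal C.toReal
            * ∑ i, sqSum (fun j => m 0 j i)) := by
          rw [ENNReal.ofReal_toReal hC]
          gcongr
          exact h m hm n
      _ ≤ ENNReal.ofReal (Δx * b ^ 2) * (ENNReal.ofReal C.toReal
            * (ENNReal.ofReal (q / a ^ 2 / Δx) * ∑' j, ENNReal.ofReal (Δx * N (m 0 j) ^ 2))) := by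
          rw [key, ← ENNReal.tsum_mul_left (a := ENNReal.ofReal (q / a ^ 2 / Δx))]
          gcongr
          rw [← ENNReal.ofReal_mul (by positivity)]
          refine ENNReal.ofReal_le_ofReal ?_
          refine (hlow _).trans_eq ?_
          field_simp
      _ = _ := by
          rw [← mul_assoc, ← mul_assoc, ← ENNReal.ofReal_mul (by positivity),
            ← ENNReal.ofReal_mul (by positivity)]
          congr 2
          field_simp

end LatticeBoltzmannScheme

/-! ### Cayley-Hamilton and the passage from finite differences to lattice Boltzmann -/

/-- For `k ∈ S` the column `k` of `X I - A` is `X` times a unit vector, so a factor `X` comes out of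
each such column. -/
lemma Matrix.X_pow_dvd_charpoly_of_col_eq_zero {n R : Type*} [Fintype n] [DecidableEq n]
    [CommRing R] (A : Matrix n n R) (S : Finset n) (h : ∀ k ∈ S, ∀ i, A i k = 0) :
    Polynomial.X ^ S.card ∣ A.charpoly := by
  let B : Matrix n n (Polynomial R) :=
    Matrix.of fun i k => if k ∈ S then (1 : Matrix n n (Polynomial R)) i k else A.charmatrix i k
  have hB : A.charmatrix = B * Matrix.diagonal fun k => if k ∈ S then Polynomial.X else 1 := by
    ext1 i k
    by_cases hk : k ∈ S
    · by_cases hik : i = k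
      · subst hik; simp [B, hk, h _ hk]
      · simp [B, hk, h _ hk, hik]
    · simp [B, hk]
  rw [Matrix.charpoly, hB, Matrix.det_mul, Matrix.det_diagonal, Finset.prod_ite_mem]
  simp

/-- The action of a matrix of Laurent polynomials on vectors of sequences. -/
def matAct {q : ℕ} (A : Matrix (Fin q) (Fin q) ℝ[T;T⁻¹]) (v : Fin q → ℤ → ℝ) : Fin q → ℤ → ℝ :=
  fun i => ∑ k, shiftHom (A i k) (v k)

lemma matAct_mul {q : ℕ} (A B : Matrix (Fin q) (Fin q) ℝ[T;T⁻¹]) (v : Fin q → ℤ → ℝ) :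
    matAct (A * B) v = matAct A (matAct B v) := by
  ext1 i
  simp only [matAct, Matrix.mul_apply, map_sum, map_mul, LinearMap.sum_apply, Module.End.mul_apply]
  exact Finset.sum_comm

lemma matAct_one {q : ℕ} (v : Fin q → ℤ → ℝ) : matAct 1 v = v := by
  ext1 i
  rw [matAct, Finset.sum_eq_single i]
  · simp
  · intro k _ hk; simp [hk.symm]
  · simp

lemma exists_sqSum_matAct_le {q : ℕ} (A : Matrix (Fin q) (Fin q) ℝ[T;T⁻¹]) :
    ∃ C : ℝ≥0∞, C ≠ ⊤ ∧ ∀ v, ∑ i, sqSum (matAct A v i) ≤ C * ∑ i, sqSum (v i) := by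
  choose C hC hle using fun i k => exists_sqSum_shiftHom_le (A i k)
  refine ⟨∑ i, (q * ∑ k, C i k), ENNReal.sum_ne_top.2 fun i _ =>
    ENNReal.mul_ne_top (by finiteness) (ENNReal.sum_ne_top.2 fun k _ => hC i k), fun v => ?_⟩
  rw [Finset.sum_mul]
  gcongr with i
  refine (sqSum_sum_le _ _).trans ?_
  rw [Finset.card_univ, Fintype.card_fin, mul_assoc, Finset.sum_mul]
  gcongr with k
  refine (hle i k _).trans ?_
  gcongr
  exact Finset.single_le_sum (f := fun i => sqSum (v i)) (fun _ _ => zero_le)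
    (Finset.mem_univ k)

namespace LatticeBoltzmannScheme

variable {q : ℕ} (L : LatticeBoltzmannScheme q)

lemma isSolution_iff (m : ℕ → ℤ → Fin q → ℝ) :
    L.IsSolution m ↔ ∀ n, (fun i j => m (n + 1) j i) = matAct L.E fun i j => m n j i := by
  simp only [IsSolution, funext_iff, matAct, shiftApply_eq, Finset.sum_apply]
  exact forall_congr' fun n => forall_comm

lemma IsSolution.eq_matAct_pow {L : LatticeBoltzmannScheme q} {m : ℕ → ℤ → Fin q → ℝ}
    (hm : L.IsSolution m) (n l : ℕ) :
    (fun i j => m (n + l) j i) = matAct (L.E ^ l) fun i j => m n j i := by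
  induction l with
  | zero => simp [matAct_one]
  | succ l ih => rw [pow_succ', matAct_mul, ← ih, ← add_assoc, (L.isSolution_iff m).1 hm]

lemma IsSolution.sum_charpoly_coeff {L : LatticeBoltzmannScheme q} {m : ℕ → ℤ → Fin q → ℝ}
    (hm : L.IsSolution m) (n : ℕ) (i : Fin q) :
    ∑ l ∈ Finset.range (q + 1), shiftHom (L.γ l) (fun j => m (n + l) j i) = 0 := by
  have h (l : ℕ) : shiftHom (L.γ l) (fun j => m (n + l) j i)
      = ∑ k, shiftHom (L.γ l * (L.E ^ l) i k) fun j => m n j k := by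
    have : (fun j => m (n + l) j i) = _ := congrFun (hm.eq_matAct_pow n l) i
    rw [this, matAct, map_sum]
    simp [Module.End.mul_apply]
  simp_rw [h]
  rw [Finset.sum_comm]
  refine Finset.sum_eq_zero fun k _ => ?_
  rw [← LinearMap.sum_apply, ← map_sum]
  have hCH := L.E.aeval_self_charpoly
  rw [Polynomial.aeval_eq_sum_range, Matrix.charpoly_natDegree_eq_dim, Fintype.card_fin] at hCH
  have := congrFun₂ hCH i k
  simp only [Matrix.sum_apply, Matrix.smul_apply, smul_eq_mul, Matrix.zero_apply] at this
  simp [γ, this]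

lemma card_eq_one_add_numNonEq :
    (Finset.univ.filter fun i : Fin q => i ≠ L.first ∧ L.s i = 1).card + L.numNonEq = q - 1 := by
  rw [numNonEq, ← Finset.filter_filter, ← Finset.filter_filter,
    Finset.card_filter_add_card_filter_not (s := {a | a ≠ L.first}) fun i => L.s i = 1]
  rw [Finset.filter_ne', Finset.card_erase_of_mem (Finset.mem_univ _)]
  simp

lemma numNonEq_add_one_le : L.numNonEq + 1 ≤ q := by
  have := L.card_eq_one_add_numNonEq
  have := L.two_le
  omega

lemma E_col_eq_zero {k : Fin q} (hk : k ≠ L.first) (hs : L.s k = 1) (i : Fin q) :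
    L.E i k = 0 := by
  have hK (p : Fin q) : L.K p k = 0 := by
    by_cases hp : p = k
    · subst hp
      simp [K, Matrix.diagonal_mul, Matrix.vecMulVec_apply, hk, hs]
    · simp [K, Matrix.diagonal_mul, Matrix.vecMulVec_apply, hk, hp]
  rw [E, Matrix.mul_apply]
  simp [hK]

lemma γ_eq_zero {l : ℕ} (hl : l + L.numNonEq + 1 < q) : L.γ l = 0 := by
  have hdvd := L.E.X_pow_dvd_charpoly_of_col_eq_zero
    (Finset.univ.filter fun i : Fin q => i ≠ L.first ∧ L.s i = 1) fun k hk i =>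
      L.E_col_eq_zero (Finset.mem_filter.1 hk).2.1 (Finset.mem_filter.1 hk).2.2 i
  have := L.card_eq_one_add_numNonEq
  exact Polynomial.X_pow_dvd_iff.1 hdvd l (by omega)

lemma γ_self : L.γ q = 1 := by
  have := L.E.charpoly_monic.coeff_natDegree
  rwa [Matrix.charpoly_natDegree_eq_dim, Fintype.card_fin] at this

/-- Each moment of a solution of the scheme satisfies the finite difference scheme, up to a shift
in time. -/
lemma IsSolution.isFDSolution {L : LatticeBoltzmannScheme q} {m : ℕ → ℤ → Fin q → ℝ}
    (hm : L.IsSolution m) (i : Fin q) :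
    L.IsFDSolution fun n j => m (n + (q - 1 - L.numNonEq)) j i := by
  intro n hn j
  have hs := L.numNonEq_add_one_le
  obtain ⟨r, rfl⟩ := Nat.exists_eq_add_of_le hn
  have h := congrFun (hm.sum_charpoly_coeff r i) j
  -- The reflection `l ↦ q - 1 - l` matches the order of the scheme; the terms with `l > s` then
  -- vanish by `γ_eq_zero`. The earliest level left is `r + (q - 1 - s)`, whence the shift in time.
  rw [Finset.sum_range_succ, γ_self, ← Finset.sum_range_reflect,
    ← Finset.sum_range_add_sum_Ico _ hs, Finset.sum_eq_zero (s := Finset.Ico _ _)] at h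
  · simp only [add_zero, map_one, Module.End.one_apply, Pi.add_apply, Pi.zero_apply,
      Finset.sum_apply] at h
    have e : L.numNonEq + r + 1 + (q - 1 - L.numNonEq) = r + q := by omega
    beta_reduce
    rw [e, eq_neg_iff_add_eq_zero, add_comm, ← h]
    congr 1
    refine Finset.sum_congr rfl fun l hl => ?_
    rw [Finset.mem_range] at hl
    rw [shiftApply_eq, Nat.sub_right_comm,
      show L.numNonEq + r - l + (q - 1 - L.numNonEq) = r + (q - 1 - l) by omega]
  · intro l hl
    rw [Finset.mem_Ico] at hl
    rw [L.γ_eq_zero (by omega), map_zero, LinearMap.zero_apply]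

lemma FDStable.exists_sqSum_le {L : LatticeBoltzmannScheme q} (h : L.FDStable) :
    ∃ C : ℝ≥0∞, C ≠ ⊤ ∧ ∀ u, L.IsFDSolution u → ∀ n,
      sqSum (u n) ≤ C * ∑ l ∈ Finset.range (L.numNonEq + 1), sqSum (u l) := by
  obtain ⟨C, hC, h⟩ := h
  refine ⟨ENNReal.ofReal C, by finiteness, fun u hu n => ?_⟩
  by_cases htop : ∑ l ∈ Finset.range (L.numNonEq + 1), sqSum (u l) = ⊤
  · rw [htop, ENNReal.mul_top (by simpa using hC)]
    exact le_top
  · have hs : ∀ l ∈ Finset.range (L.numNonEq + 1), Summable fun j => u l j ^ 2 := fun l hl =>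
      -- Finite total energy yields the summability that `FDStable` demands of the initial data.
      summable_of_sqSum_ne_top ((ENNReal.sum_ne_top.1 htop) l hl)
    have := h 1 one_pos u hu (by simpa using hs) n
    simp only [one_mul, sq_abs] at this
    rw [← ofReal_tsum_sq this.1, ← Finset.sum_congr rfl fun l hl => ofReal_tsum_sq (hs l hl),
      ← ENNReal.ofReal_sum_of_nonneg fun l _ => tsum_nonneg fun j => sq_nonneg _,
      ← ENNReal.ofReal_mul hC.le]
    exact ENNReal.ofReal_le_ofReal this.2

theorem FDStable.l2Stable {L : LatticeBoltzmannScheme q} (h : L.FDStable) : L.L2Stable := by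
  obtain ⟨C, hC, hCle⟩ := h.exists_sqSum_le
  obtain ⟨B, hB, hBle⟩ : ∃ B : ℝ≥0∞, B ≠ ⊤ ∧ ∀ m, L.IsSolution m → ∀ n ≤ q,
      ∑ i, sqSum (fun j => m n j i) ≤ B * ∑ i, sqSum (fun j => m 0 j i) := by
    choose B hB hle using fun n => exists_sqSum_matAct_le (L.E ^ n)
    refine ⟨∑ n ∈ Finset.range (q + 1), B n, ENNReal.sum_ne_top.2 fun n _ => hB n, fun m hm n hn => ?_⟩
    have := hle n fun i j => m 0 j i
    rw [← hm.eq_matAct_pow, zero_add] at this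
    refine this.trans ?_
    gcongr
    exact Finset.single_le_sum (fun _ _ => zero_le) (Finset.mem_range.2 (by omega))
  have hs := L.numNonEq_add_one_le
  -- `B` covers the times up to `q`, which include the shifted initial levels; the factor `q` bounds
  -- their number `s + 1`.
  refine L.L2Stable_of_sqSum_le (C := B + C * (q * B)) (by finiteness) fun m hm n => ?_
  rw [add_mul]
  rcases le_total n q with hn | hn
  · exact (hBle m hm n hn).trans le_self_add
  · refine le_trans ?_ le_add_self
    calc ∑ i, sqSum (fun j => m n j i)
        ≤ ∑ i, C * ∑ l ∈ Finset.range (L.numNonEq + 1),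
            sqSum (fun j => m (l + (q - 1 - L.numNonEq)) j i) := by
          gcongr with i
          have := hCle _ (hm.isFDSolution i) (n - (q - 1 - L.numNonEq))
          rwa [Nat.sub_add_cancel (by omega)] at this
      _ = C * ∑ l ∈ Finset.range (L.numNonEq + 1),
            ∑ i, sqSum (fun j => m (l + (q - 1 - L.numNonEq)) j i) := by
          rw [← Finset.mul_sum, Finset.sum_comm]
      _ ≤ C * ∑ l ∈ Finset.range (L.numNonEq + 1), B * ∑ i, sqSum (fun j => m 0 j i) := by
          gcongr with l hl
          rw [Finset.mem_range] at hl
          exact hBle m hm _ (by omega)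
      _ ≤ C * (q * B) * ∑ i, sqSum (fun j => m 0 j i) := by
          rw [Finset.sum_const, Finset.card_range, nsmul_eq_mul, mul_assoc, mul_assoc]
          gcongr

end LatticeBoltzmannScheme

/-! ### Stability from a non-expansive collision -/

namespace LatticeBoltzmannScheme

variable {q : ℕ} (L : LatticeBoltzmannScheme q)

/-- Collision followed by transport. -/
lemma matAct_E (v : Fin q → ℤ → ℝ) :
    matAct L.E v = fun i j =>
      ∑ p, L.M.val i p * ((L.M⁻¹.val * L.K).mulVec fun k => v k (j - L.c p)) p := by
  ext i j
  rw [E, Matrix.mul_assoc, ← Matrix.map_mul, matAct_mul, matAct_mul]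
  simp only [matAct, Matrix.map_apply, shiftHom_C, Finset.sum_apply, Pi.smul_apply, smul_eq_mul]
  refine Finset.sum_congr rfl fun p _ => ?_
  rw [Finset.sum_eq_single p]
  · simp [shiftHom_T, Matrix.mulVec, dotProduct, sub_eq_add_neg]
  · intro k _ hk
    simp [Matrix.diagonal_apply_ne _ hk.symm]
  · simp

lemma IsSolution.inv_mulVec_succ {L : LatticeBoltzmannScheme q} {m : ℕ → ℤ → Fin q → ℝ}
    (hm : L.IsSolution m) (n : ℕ) (j : ℤ) (p : Fin q) :
    L.M⁻¹.val.mulVec (m (n + 1) j) p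
      = (L.M⁻¹.val * L.K * L.M.val).mulVec (L.M⁻¹.val.mulVec (m n (j - L.c p))) p := by
  have h : m (n + 1) j = L.M.val.mulVec fun p => (L.M⁻¹.val * L.K).mulVec (m n (j - L.c p)) p := by
    ext i
    exact congrFun₂ (((L.isSolution_iff m).1 hm n).trans (L.matAct_E _)) i j
  rw [h, Matrix.mulVec_mulVec, Matrix.mulVec_mulVec, Units.inv_mul, Matrix.one_mulVec,
    Matrix.mul_assoc, Units.mul_inv, Matrix.mul_one]

/-- If the collision operator `M⁻¹ K M` does not increase a positive diagonal quadratic form, then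
the scheme is stable. -/
theorem l2Stable_of_collision_le (α : Fin q → ℝ) (hα : ∀ i, 0 < α i)
    (h : ∀ v : Fin q → ℝ,
      ∑ i, α i * (L.M⁻¹.val * L.K * L.M.val).mulVec v i ^ 2 ≤ ∑ i, α i * v i ^ 2) :
    L.L2Stable := by
  let f (m : ℤ → Fin q → ℝ) (i : Fin q) (j : ℤ) : ℝ := L.M⁻¹.val.mulVec (m j) i
  have hdecr (m) (hm : L.IsSolution m) (n : ℕ) :
      ∑ i, ENNReal.ofReal (α i) * sqSum (f (m n) i)
        ≤ ∑ i, ENNReal.ofReal (α i) * sqSum (f (m 0) i) := by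
    induction n with
    | zero => rfl
    | succ n ih =>
      refine le_trans ?_ ih
      -- In the distribution functions `M⁻¹ m`, transport translates each component separately and
      -- leaves its sum of squares unchanged, so only the pointwise collision matters.
      have hstep (i : Fin q) : sqSum (f (m (n + 1)) i) = sqSum fun j =>
          (L.M⁻¹.val * L.K * L.M.val).mulVec (fun k => f (m n) k j) i := by
        rw [← sqSum_shift (L.c i)]
        congr 1
        ext j
        have := hm.inv_mulVec_succ n (j + L.c i) i
        rwa [add_sub_cancel_right] at this
      have hsum (w : Fin q → ℤ → ℝ) : ∑ i, ENNReal.ofReal (α i) * sqSum (w i)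
          = ∑' j, ENNReal.ofReal (∑ i, α i * w i j ^ 2) := by
        simp_rw [sqSum, ← ENNReal.tsum_mul_left, ← ENNReal.ofReal_mul (hα _).le]
        rw [← Summable.tsum_finsetSum fun i _ => ENNReal.summable]
        exact tsum_congr fun j => (ENNReal.ofReal_sum_of_nonneg fun i _ =>
          mul_nonneg (hα i).le (sq_nonneg _)).symm
      simp_rw [hstep]
      rw [hsum, hsum]
      exact ENNReal.tsum_le_tsum fun j => ENNReal.ofReal_le_ofReal (h _)
  obtain ⟨A, hA, hAle⟩ := exists_sqSum_matAct_le (L.M.val.map LaurentPolynomial.C)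
  obtain ⟨B, hB, hBle⟩ := exists_sqSum_matAct_le (L.M⁻¹.val.map LaurentPolynomial.C)
  have hf (m : ℤ → Fin q → ℝ) :
      matAct (L.M⁻¹.val.map LaurentPolynomial.C) (fun i j => m j i) = f m := by
    ext i j
    simp [matAct, shiftHom_C, f, Matrix.mulVec, dotProduct]
  have hf' (m : ℤ → Fin q → ℝ) :
      matAct (L.M.val.map LaurentPolynomial.C) (f m) = fun i j => m j i := by
    rw [← hf, ← matAct_mul, ← Matrix.map_mul, Units.mul_inv, Matrix.map_one _ (map_zero _)
      (map_one _), matAct_one]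
  obtain ⟨a, ha, hale⟩ : ∃ a : ℝ, 0 < a ∧ ∀ i, a ≤ α i := by
    have := L.two_le
    have : Nonempty (Fin q) := ⟨L.first⟩
    obtain ⟨i, hi⟩ := Finite.exists_min α
    exact ⟨α i, hα i, hi⟩
  -- `A` and `B` are the costs of applying `M` and `M⁻¹`; the middle factor compares weighted with
  -- unweighted sums.
  refine L.L2Stable_of_sqSum_le (C := A * ((ENNReal.ofReal a)⁻¹ * (∑ i, ENNReal.ofReal (α i)) * B))
    ?_ fun m hm n => ?_
  · have : (ENNReal.ofReal a)⁻¹ ≠ ⊤ := by simpa using ha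
    have : ∑ i, ENNReal.ofReal (α i) ≠ ⊤ := ENNReal.sum_ne_top.2 fun i _ => ENNReal.ofReal_ne_top
    finiteness
  · calc ∑ i, sqSum (fun j => m n j i)
        = ∑ i, sqSum (matAct (L.M.val.map LaurentPolynomial.C) (f (m n)) i) := by rw [hf']
      _ ≤ A * ∑ i, sqSum (f (m n) i) := hAle _
      _ ≤ A * ((ENNReal.ofReal a)⁻¹ * ∑ i, ENNReal.ofReal (α i) * sqSum (f (m n) i)) := by
          gcongr
          rw [Finset.mul_sum]
          gcongr with i
          rw [← mul_assoc]
          refine le_mul_of_one_le_left (zero_le) ?_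
          rw [← ENNReal.inv_mul_cancel (a := ENNReal.ofReal a) (by simpa using ha) (by simp)]
          gcongr
          exact hale i
      _ ≤ A * ((ENNReal.ofReal a)⁻¹ * ∑ i, ENNReal.ofReal (α i) * sqSum (f (m 0) i)) := by
          gcongr _ * (_ * ?_)
          exact hdecr m hm n
      _ ≤ A * ((ENNReal.ofReal a)⁻¹ * ((∑ i, ENNReal.ofReal (α i)) * ∑ i, sqSum (f (m 0) i))) := by
          gcongr
          rw [Finset.sum_mul]
          gcongr with i
          exact Finset.single_le_sum (f := fun i => sqSum (f (m 0) i)) (fun _ _ => zero_le)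
            (Finset.mem_univ i)
      _ ≤ A * ((ENNReal.ofReal a)⁻¹ * ((∑ i, ENNReal.ofReal (α i))
            * (B * ∑ i, sqSum (fun j => m 0 j i)))) := by
          gcongr
          rw [← hf]
          exact hBle _
      _ = _ := by ring

/-! ### Instability detected on sequences constant in space -/

/-- The solution of the finite difference scheme with given initial data. -/
def fdSolution (init : ℕ → ℤ → ℝ) : ℕ → ℤ → ℝ
  | n => if n ≤ L.numNonEq then init n else fun j =>
      -∑ l : Fin (L.numNonEq + 1),
        -- Here `n > s`, so the default 0 is never used; the test supplies `n ≠ 0` to the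
        -- termination proof.
        shiftApply (L.γ (q - l - 1)) (if _h : n ≠ 0 then fdSolution init (n - 1 - l) else 0) j
termination_by n => n
decreasing_by omega

lemma fdSolution_of_le (init : ℕ → ℤ → ℝ) {n : ℕ} (hn : n ≤ L.numNonEq) :
    L.fdSolution init n = init n := by
  rw [fdSolution, if_pos hn]

lemma fdSolution_succ (init : ℕ → ℤ → ℝ) {n : ℕ} (hn : L.numNonEq ≤ n) (j : ℤ) :
    L.fdSolution init (n + 1) j = -∑ l ∈ Finset.range (L.numNonEq + 1),
      shiftApply (L.γ (q - l - 1)) (L.fdSolution init (n - l)) j := by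
  rw [fdSolution, if_neg (by omega)]
  simp [Finset.sum_range]

/-- The evaluation of Laurent polynomials at `1`. -/
def evalOne : ℝ[T;T⁻¹] →+* ℝ := LaurentPolynomial.eval₂ (RingHom.id ℝ) 1

/-- Shifts fix constants, so `P` acts on them as `P(1)`; its finite support makes the statement
local. -/
lemma exists_shiftApply_eq_evalOne_mul (P : ℝ[T;T⁻¹]) :
    ∃ R : ℕ, ∀ (u : ℤ → ℝ) (a : ℝ) (j : ℤ), (∀ k, |k - j| ≤ R → u k = a) →
      shiftApply P u j = evalOne P * a := by
  simp_rw [shiftApply_eq]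
  induction P using LaurentPolynomial.induction_on' with
  | add p r hp hr =>
    obtain ⟨R, hR⟩ := hp
    obtain ⟨R', hR'⟩ := hr
    refine ⟨R + R', fun u a j h => ?_⟩
    rw [map_add, map_add, add_mul, LinearMap.add_apply, Pi.add_apply,
      hR u a j fun k hk => h k (by push_cast; omega),
      hR' u a j fun k hk => h k (by push_cast; omega)]
  | C_mul_T n b =>
    refine ⟨n.natAbs, fun u a j h => ?_⟩
    rw [map_mul, Module.End.mul_apply, shiftHom_C, Pi.smul_apply, shiftHom_T,
      h _ (by simp)]
    simp [evalOne]

/-- If the scheme acting on sequences that are constant in space has an unbounded solution,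
then it is not stable. -/
theorem not_fdStable_of_unbounded (c : ℕ → ℝ)
    (hc : ∀ n, L.numNonEq ≤ n → c (n + 1)
      = -∑ l ∈ Finset.range (L.numNonEq + 1), evalOne (L.γ (q - l - 1)) * c (n - l))
    (hunb : ∀ B : ℝ, ∃ n, B < c n ^ 2) : ¬ L.FDStable := by
  rintro ⟨C, hC, h⟩
  obtain ⟨R, hR⟩ : ∃ R : ℕ, ∀ l (u : ℤ → ℝ) (a : ℝ) (j : ℤ), l ≤ L.numNonEq →
      (∀ k, |k - j| ≤ R → u k = a) →
      shiftApply (L.γ (q - l - 1)) u j = evalOne (L.γ (q - l - 1)) * a := by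
    choose R hR using fun l => exists_shiftApply_eq_evalOne_mul (L.γ (q - l - 1))
    refine ⟨∑ l ∈ Finset.range (L.numNonEq + 1), R l, fun l u a j hl hu =>
      hR l u a j fun k hk => hu k (hk.trans ?_)⟩
    exact_mod_cast Finset.single_le_sum (f := R) (fun _ _ => Nat.zero_le _)
      (Finset.mem_range.2 (by omega))
  obtain ⟨n, hn⟩ := hunb (2 * C * ∑ l ∈ Finset.range (L.numNonEq + 1), c l ^ 2)
  -- Errors from the truncation travel at most `R` points per step. At time `n` the solution is
  -- still `c n` on `W + 1` points, against `2 * W + 1` points initially; this ratio below 2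
  -- explains the factor 2 in `hn`.
  let W : ℤ := 2 * (n * R)
  let init : ℕ → ℤ → ℝ := fun l => (Set.Icc (-W) W).indicator fun _ => c l
  set u := L.fdSolution init with hu
  have hprop (k : ℕ) : ∀ j : ℤ, |j| ≤ W - k * R → u k j = c k := by
    induction k using Nat.strong_induction_on with
    | _ k ih =>
      intro j hj
      rcases le_or_gt k L.numNonEq with hk | hk
      · rw [hu, L.fdSolution_of_le _ hk]
        refine Set.indicator_of_mem ?_ _
        rw [Set.mem_Icc, ← abs_le]
        have : (0 : ℤ) ≤ k * R := by positivity
        omega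
      · obtain ⟨k, rfl⟩ : ∃ k', k = k' + 1 := ⟨k - 1, by omega⟩
        rw [hu, L.fdSolution_succ _ (by omega), hc _ (by omega)]
        congr 1
        refine Finset.sum_congr rfl fun l hl => ?_
        rw [Finset.mem_range] at hl
        refine hR l _ _ _ (by omega) fun i hi => ih _ (by omega) i ?_
        have h1 : ((k - l : ℕ) : ℤ) * R ≤ k * R := by gcongr; omega
        push_cast at hj
        rw [add_one_mul] at hj
        have := abs_sub_abs_le_abs_sub i j
        omega
  have hinit (l : ℕ) : (fun j => (1 : ℝ) * |init l j| ^ 2)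
      = fun j => if j ∈ Finset.Icc (-W) W then c l ^ 2 else 0 := by
    ext j
    simp only [init, Set.indicator, Finset.mem_Icc, Set.mem_Icc]
    split_ifs <;> simp
  have hW : 0 ≤ W := by positivity
  have htsum (l : ℕ) (hl : l ≤ L.numNonEq) :
      ∑' j, (1 : ℝ) * |u l j| ^ 2 = (2 * W + 1) * c l ^ 2 := by
    rw [hu, L.fdSolution_of_le _ hl, hinit, tsum_eq_sum (s := Finset.Icc (-W) W) (by simp_all)]
    rw [Finset.sum_ite_mem, Finset.inter_self, Finset.sum_const, Int.card_Icc, nsmul_eq_mul]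
    congr 1
    have : ((W + 1 - -W).toNat : ℤ) = 2 * W + 1 := by omega
    exact_mod_cast this
  obtain ⟨hs, hle⟩ := h 1 one_pos u (fun k hk j => L.fdSolution_succ _ hk j) (fun l hl => by
    rw [hu, L.fdSolution_of_le _ (by rw [Finset.mem_range] at hl; omega), hinit]
    exact summable_of_ne_finset_zero (s := Finset.Icc (-W) W) (by simp_all)) n
  have hlow : (W + 1) * c n ^ 2 ≤ ∑' j, (1 : ℝ) * |u n j| ^ 2 := by
    refine le_trans (le_of_eq ?_) (hs.sum_le_tsum (Finset.Icc (-(n * R : ℤ)) (n * R))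
      fun j _ => by positivity)
    rw [Finset.sum_congr rfl fun j hj => by
      rw [hprop n j (by rw [Finset.mem_Icc, ← abs_le] at hj; simp only [W]; omega)]]
    rw [Finset.sum_const, Int.card_Icc, nsmul_eq_mul, one_mul, sq_abs]
    congr 1
    have : ((n * R + 1 - -(n * R : ℤ)).toNat : ℤ) = W + 1 := by
      have : (0 : ℤ) ≤ n * R := by positivity
      omega
    exact_mod_cast this.symm
  rw [Finset.sum_congr rfl fun l hl => htsum l (by rw [Finset.mem_range] at hl; omega),
    ← Finset.mul_sum] at hle
  have hW' : (0 : ℝ) ≤ W := by exact_mod_cast hW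
  have hS : 0 ≤ ∑ l ∈ Finset.range (L.numNonEq + 1), c l ^ 2 := by positivity
  have h1 := hlow.trans hle
  have h2 := mul_lt_mul_of_pos_left hn (show (0 : ℝ) < W + 1 by linarith)
  nlinarith [mul_nonneg hC.le hS]

/-- At `T = 1` the transport matrix is the identity, `M` and `M⁻¹` cancel, and `E` becomes `K`. -/
lemma charpoly_map_evalOne : L.E.charpoly.map evalOne = L.K.charpoly := by
  have hC : (evalOne : ℝ[T;T⁻¹] → ℝ) ∘ LaurentPolynomial.C = id := by
    ext a; simp [evalOne]
  have hmap (A : Matrix (Fin q) (Fin q) ℝ) : (A.map LaurentPolynomial.C).map evalOne = A := by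
    rw [Matrix.map_map, hC, Matrix.map_id]
  rw [← Matrix.charpoly_map, E, Matrix.map_mul, Matrix.map_mul, Matrix.map_mul, hmap, hmap, hmap,
    Matrix.diagonal_map (map_zero _)]
  simp [evalOne, LaurentPolynomial.eval₂_T]

lemma evalOne_γ (l : ℕ) : evalOne (L.γ l) = L.K.charpoly.coeff l := by
  rw [← charpoly_map_evalOne, Polynomial.coeff_map, γ]

end LatticeBoltzmannScheme

/-! ### The counterexample with three velocities -/

/-- A moment matrix for three velocities; the conserved moment is the sum of the distribution
functions. -/
def d1q3Moments : Matrix.GeneralLinearGroup (Fin 3) ℝ where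
  val := !![1, 1, 1; 0, 1, -1; 0, 1, 1]
  inv := !![1, 0, -1; 0, 1 / 2, 1 / 2; 0, -1 / 2, 1 / 2]
  val_inv := by
    ext i j
    fin_cases i <;> fin_cases j <;> simp [Matrix.mul_apply, Fin.sum_univ_three] <;> norm_num
  inv_val := by
    ext i j
    fin_cases i <;> fin_cases j <;> simp [Matrix.mul_apply, Fin.sum_univ_three] <;> norm_num

/-- The scheme with velocities `0, 1, -1`, equilibrium weights `1/4, 1/2, 1/4` and all relaxation
parameters equal to `2`. -/
def d1q3Scheme : LatticeBoltzmannScheme 3 where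
  two_le := by norm_num
  c := ![0, 1, -1]
  M := d1q3Moments
  ε := ![1, 1 / 4, 3 / 4]
  s := fun _ => 2
  ε_first := rfl
  s_mem := fun _ _ => by norm_num

lemma d1q3Scheme_M : d1q3Scheme.M.val = !![1, 1, 1; 0, 1, -1; 0, 1, 1] := rfl

lemma d1q3Scheme_M_inv :
    d1q3Scheme.M⁻¹.val = !![1, 0, -1; 0, 1 / 2, 1 / 2; 0, -1 / 2, 1 / 2] := rfl

lemma d1q3Scheme_c : d1q3Scheme.c = ![0, 1, -1] := rfl

lemma d1q3Scheme_ε : d1q3Scheme.ε = ![1, 1 / 4, 3 / 4] := rfl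

lemma d1q3Scheme_s (i : Fin 3) : d1q3Scheme.s i = 2 := rfl

lemma d1q3Scheme_first : d1q3Scheme.first = 0 := rfl

lemma d1q3Scheme_K : d1q3Scheme.K = !![1, 0, 0; 1 / 2, -1, 0; 3 / 2, 0, -1] := by
  ext i j
  simp only [LatticeBoltzmannScheme.K, d1q3Scheme_first, d1q3Scheme_s, d1q3Scheme_ε,
    Matrix.add_apply, Matrix.sub_apply, Matrix.diagonal_mul, Matrix.vecMulVec_apply]
  fin_cases i <;> fin_cases j <;> simp <;> norm_num

lemma d1q3Scheme_numNonEq : d1q3Scheme.numNonEq = 2 := by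
  have : (Finset.univ.filter fun i : Fin 3 => i ≠ d1q3Scheme.first ∧ d1q3Scheme.s i ≠ 1)
      = Finset.univ.erase 0 := by
    ext i
    simp [d1q3Scheme_first, d1q3Scheme_s]
  rw [LatticeBoltzmannScheme.numNonEq, this]
  rfl

lemma d1q3Scheme_collision :
    d1q3Scheme.M⁻¹.val * d1q3Scheme.K * d1q3Scheme.M.val
      = !![-1 / 2, 1 / 2, 1 / 2; 1, 0, 1; 1 / 2, 1 / 2, -1 / 2] := by
  rw [d1q3Scheme_K, d1q3Scheme_M, d1q3Scheme_M_inv]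
  ext i j
  fin_cases i <;> fin_cases j <;>
    simp [Matrix.mul_apply, Fin.sum_univ_three] <;> norm_num

theorem d1q3Scheme_l2Stable : d1q3Scheme.L2Stable := by
  -- Collision is `f ↦ 2 w (∑ f) - f` with `w = (1/4, 1/2, 1/4)`: the reflection fixing `w`,
  -- orthogonal for the form with weights `1 / w i`, proportional to `(2, 1, 2)`. Hence equality.
  refine d1q3Scheme.l2Stable_of_collision_le ![2, 1, 2]
    (fun i => by fin_cases i <;> norm_num) fun v => le_of_eq ?_
  rw [d1q3Scheme_collision]
  simp [Matrix.mulVec, dotProduct, Fin.sum_univ_three]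
  ring

lemma d1q3Scheme_isConsistent : d1q3Scheme.IsConsistent (1 / 4) 1 := by
  rw [LatticeBoltzmannScheme.IsConsistent, d1q3Scheme_first, d1q3Scheme_M, d1q3Scheme_M_inv,
    d1q3Scheme_c, d1q3Scheme_ε]
  simp [Matrix.mulVec, dotProduct, Matrix.mul_apply, Fin.sum_univ_three, Matrix.vecMul_diagonal]
  norm_num

lemma d1q3Scheme_K_charpoly :
    d1q3Scheme.K.charpoly = Polynomial.X ^ 3 + Polynomial.X ^ 2 - Polynomial.X - 1 := by
  rw [d1q3Scheme_K, Matrix.charpoly, Matrix.det_fin_three]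
  simp
  ring

theorem d1q3Scheme_not_fdStable : ¬ d1q3Scheme.FDStable := by
  -- The polynomial factors as `(X - 1)(X + 1)^2`, and the double root -1 produces the factor `n`.
  refine d1q3Scheme.not_fdStable_of_unbounded (fun n => (-1) ^ n * n) (fun n hn => ?_) fun B => ?_
  · rw [d1q3Scheme_numNonEq] at hn ⊢
    obtain ⟨n, rfl⟩ := Nat.exists_eq_add_of_le' hn
    simp only [LatticeBoltzmannScheme.evalOne_γ, d1q3Scheme_K_charpoly, Finset.sum_range_succ,
      Finset.sum_range_zero]
    simp [Polynomial.coeff_X, Polynomial.coeff_one, Polynomial.coeff_X_pow]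
    ring
  · obtain ⟨n, hn⟩ := exists_nat_gt (max B 1)
    refine ⟨n, ?_⟩
    have h1 := (le_max_left B 1).trans_lt hn
    have h2 := (le_max_right B 1).trans_lt hn
    rw [mul_pow, ← pow_mul, mul_comm n, pow_mul, neg_one_sq, one_pow, one_mul]
    nlinarith

end

theorem mainTheorem6 :
    (∀ (q : ℕ) (L : LatticeBoltzmannScheme q), L.FDStable → L.L2Stable) ∧
    (∃ (q : ℕ) (L : LatticeBoltzmannScheme q),
      (∃ i, 0 ≤ L.c i) ∧ (∃ i, L.c i ≤ 0) ∧
      (∃ V lam : ℝ, V ≠ 0 ∧ 0 < lam ∧ L.IsConsistent V lam) ∧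
      L.L2Stable ∧ ¬ L.FDStable) := by
  refine ⟨fun q L h => h.l2Stable, 3, d1q3Scheme, ⟨0, le_rfl⟩, ⟨0, le_rfl⟩,
    ⟨1 / 4, 1, by norm_num, one_pos, d1q3Scheme_isConsistent⟩, d1q3Scheme_l2Stable,
    d1q3Scheme_not_fdStable⟩
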